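/- **Conventions.** Let $\mathcal T$ be a triangulated category. A functor from $\mathcal T$ to an abelian category is *cohomological* if it is additive and sends every exact triangle $X\to Y\to Z\to X[1]$ to an exact sequence $F(X)\to F(Y)\to F(Z)$. The *abelianisation* $\iota_{\mathcal T}\colon \mathcal T\to \mathrm{Ab}(\mathcal T)$ is the fully faithful cohomological functor into an abelian category that is characterised, up to equivalence, by the property that for every abelian category $\mathcal A$ restriction along $\iota_{\mathcal T}$ is an equivalence from the category of exact functors $\mathrm{Ab}(\mathcal T)\to\mathcal A$ to the category of cohomological functors $\mathcal T\to\mathcal A$. It is realised by the Freyd category of $\mathcal T$: objects are the morphisms $u\colon X'\to X$ of $\mathcal T$ (standing for the cokernel of $\mathrm{Hom}(-,u)$), morphisms from $u\colon X'\to X$ to $v\colon Y'\to Y$ are commutative squares from $u$ to $v$ modulo those whose component $X\to Y$ factors through $v$, and $\iota_{\mathcal T}(X)$ is $0\to X$. For a Serre subcategory $\mathcal C$ of an abelian category $\mathcal A$, the quotient $\mathcal A/\mathcal C$ is the localisation of $\mathcal A$ at the class of morphisms whose kernel and cokernel belong to $\mathcal C$. **Proposition.** Let $\mathcal T$ be a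 triangulated category, let $\mathcal S\subseteq\mathcal T$ be a (full) triangulated subcategory, and let $L\colon\mathcal T\to\mathcal T/\mathcal S$ be the Verdier quotient functor, i.e. an exact functor of triangulated categories that is the localisation of $\mathcal T$ at the class of morphisms whose cone belongs to $\mathcal S$. Let $\mathrm{Ab}(L)\colon\mathrm{Ab}(\mathcal T)\to\mathrm{Ab}(\mathcal T/\mathcal S)$ be the canonical functor, that is, the extension of the cohomological functor $\iota_{\mathcal T/\mathcal S}\circ L$ along $\iota_{\mathcal T}$. It is exact and satisfies $\mathrm{Ab}(L)\circ\iota_{\mathcal T}\cong\iota_{\mathcal T/\mathcal S}\circ L$. Let $\mathrm{Ab}_{\mathcal S}(\mathcal T)$ be the Serre subcategory of $\mathrm{Ab}(\mathcal T)$ generated by the objects $\iota_{\mathcal T}(X)$ with $X\in\mathcal S$. Then $\mathrm{Ab}(L)$ inverts every morphism of $\mathrm{Ab}(\mathcal T)$ whose kernel and cokernel belong to $\mathrm{Ab}_{\mathcal S}(\mathcal T)$, and the induced functor $$\mathrm{Ab}(\mathcal T)/\mathrm{Ab}_{\mathcal S}(\mathcal T)\longrightarrow\mathrm{Ab}(\mathcal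 T/\mathcal S)$$ is an equivalence of categories. -/

import Mathlib

open CategoryTheory Category Limits Preadditive Pretriangulated

set_option linter.unusedSectionVars false

namespace Abelianisation

section Freyd

/-! The Freyd category of a triangulated category is abelian, and it is the abelianisation. -/

variable {T : Type*} [Category* T] [Preadditive T] {u v w : Arrow T}

lemma quotient_map_eq_zero_iff (f : u ⟶ v) :
    (RightFreyd.quotient T).map f = 0 ↔ ∃ h : u.right ⟶ v.left, f.right = h ≫ v.hom := by
  rw [RightFreyd.quotient_map_eq_zero_iff]
  exact ⟨fun ⟨h⟩ ↦ ⟨h.hom, by simpa using h.comm⟩, fun ⟨h, hh⟩ ↦ ⟨⟨h, by simpa using hh⟩⟩⟩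

lemma quotient_map_eq_iff (f g : u ⟶ v) :
    (RightFreyd.quotient T).map f = (RightFreyd.quotient T).map g ↔
      ∃ h : u.right ⟶ v.left, f.right - g.right = h ≫ v.hom := by
  rw [RightFreyd.quotient_map_eq_iff]
  exact ⟨fun ⟨h⟩ ↦ ⟨h.hom, h.comm⟩, fun ⟨h, hh⟩ ↦ ⟨⟨h, hh⟩⟩⟩

variable [HasZeroObject T] [HasShift T ℤ]
  [∀ n : ℤ, (shiftFunctor T n).Additive] [Pretriangulated T]

instance hasZeroObject_rightFreyd : HasZeroObject (RightFreyd T) :=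
  ⟨_, (RightFreyd.functor T).map_isZero (isZero_zero T)⟩

instance hasBinaryBiproducts_rightFreyd : HasBinaryBiproducts (RightFreyd T) where
  has_binary_biproduct a b := by
    obtain ⟨u, rfl⟩ : ∃ u, (RightFreyd.quotient T).obj u = a := ⟨a.as, rfl⟩
    obtain ⟨v, rfl⟩ : ∃ v, (RightFreyd.quotient T).obj v = b := ⟨b.as, rfl⟩
    let c : BinaryBicone u v :=
      { pt := Arrow.mk (biprod.map u.hom v.hom)
        fst := Arrow.homMk biprod.fst biprod.fst
        snd := Arrow.homMk biprod.snd biprod.snd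
        inl := Arrow.homMk biprod.inl biprod.inl
        inr := Arrow.homMk biprod.inr biprod.inr }
    have hc : c.fst ≫ c.inl + c.snd ≫ c.inr = 𝟙 c.pt := by
      ext <;> simp [c]
    exact ⟨⟨_, isBinaryBilimitOfTotal ((RightFreyd.quotient T).mapBinaryBicone c) (by
      have h := congr((RightFreyd.quotient T).map $hc)
      simpa using! h)⟩⟩

instance hasFiniteProducts_rightFreyd : HasFiniteProducts (RightFreyd T) :=
  hasFiniteProducts_of_has_binary_and_terminal

/-- Triangulated categories have weak pullbacks. -/
lemma exists_weakPullback {X Y Z : T} (f : X ⟶ Z) (g : Y ⟶ Z) :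
    ∃ (K : T) (p : K ⟶ X) (q : K ⟶ Y), p ≫ f = q ≫ g ∧
      ∀ ⦃W : T⦄ (a : W ⟶ X) (b : W ⟶ Y), a ≫ f = b ≫ g →
        ∃ l : W ⟶ K, l ≫ p = a ∧ l ≫ q = b := by
  obtain ⟨K, k, δ, hT⟩ := distinguished_cocone_triangle₁ (biprod.desc f (-g))
  refine ⟨K, k ≫ biprod.fst, k ≫ biprod.snd, ?_, fun W a b h ↦ ?_⟩
  · have h : k ≫ biprod.desc f (-g) = 0 := comp_distTriang_mor_zero₁₂ _ hT
    rw [biprod.desc_eq, comp_add, comp_neg, comp_neg, add_neg_eq_zero] at h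
    simpa using h
  · have h0 : biprod.lift a b ≫ biprod.desc f (-g) = 0 := by
      rw [biprod.lift_desc, h, comp_neg, add_neg_cancel]
    obtain ⟨l, hl⟩ : ∃ l : W ⟶ K, biprod.lift a b = l ≫ k :=
      Triangle.coyoneda_exact₂ _ hT (biprod.lift a b) h0
    exact ⟨l, by simp [← reassoc_of% hl], by simp [← reassoc_of% hl]⟩

/-- A kernel in the Freyd category of the morphism induced by `f : u ⟶ v`, constructed from two
weak pullbacks in `T`. -/
lemma exists_kernel (f : u ⟶ v) :
    ∃ (k : Arrow T) (ι : k ⟶ u) (q : k.right ⟶ v.left) (hι : ι.right ≫ f.right = q ≫ v.hom),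
      (∀ ⦃W : T⦄ (a : W ⟶ u.right) (b : W ⟶ v.left), a ≫ f.right = b ≫ v.hom →
        ∃ l : W ⟶ k.right, l ≫ ι.right = a ∧ l ≫ q = b) ∧
      Nonempty (IsLimit (KernelFork.ofι (f := (RightFreyd.quotient T).map f)
        ((RightFreyd.quotient T).map ι)
          (by rw [← Functor.map_comp, quotient_map_eq_zero_iff]; exact ⟨q, by simpa using hι⟩))) := by
  obtain ⟨K, p, q, hpq, hK⟩ := exists_weakPullback f.right v.hom
  obtain ⟨M, m, n, hmn, hM⟩ := exists_weakPullback p u.hom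
  have hw (a : RightFreyd T) (g : a ⟶ (RightFreyd.quotient T).obj u)
      (hg : g ≫ (RightFreyd.quotient T).map f = 0) :
      ∃ l : a ⟶ (RightFreyd.quotient T).obj (Arrow.mk m),
        l ≫ (RightFreyd.quotient T).map (Arrow.homMk n p hmn.symm : Arrow.mk m ⟶ u) = g := by
    obtain ⟨w, rfl⟩ : ∃ w, (RightFreyd.quotient T).obj w = a := ⟨a.as, rfl⟩
    obtain ⟨g, rfl⟩ := (RightFreyd.quotient T).map_surjective g
    rw [← Functor.map_comp, quotient_map_eq_zero_iff] at hg
    obtain ⟨h, hh⟩ := hg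
    obtain ⟨l, hl, -⟩ := hK g.right h (by simpa using hh)
    obtain ⟨l', hl', hl''⟩ := hM (w.hom ≫ l) g.left (by simp [hl])
    refine ⟨(RightFreyd.quotient T).map (Arrow.homMk l' l hl'), ?_⟩
    rw [← Functor.map_comp]
    congr 1
    ext <;> simp [hl, hl'']
  have : Mono ((RightFreyd.quotient T).map (Arrow.homMk n p hmn.symm : Arrow.mk m ⟶ u)) := by
    rw [mono_iff_cancel_zero]
    intro a g hg
    obtain ⟨w, rfl⟩ : ∃ w, (RightFreyd.quotient T).obj w = a := ⟨a.as, rfl⟩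
    obtain ⟨g, rfl⟩ := (RightFreyd.quotient T).map_surjective g
    rw [← Functor.map_comp, quotient_map_eq_zero_iff] at hg
    obtain ⟨h, hh⟩ := hg
    obtain ⟨l, hl, -⟩ := hM g.right h (by simpa using hh)
    exact (quotient_map_eq_zero_iff _).2 ⟨l, hl.symm⟩
  exact ⟨Arrow.mk m, Arrow.homMk n p hmn.symm, q, hpq, hK,
    ⟨KernelFork.IsLimit.ofι' _ _ fun {a} g hg ↦ ⟨_, (hw a g hg).choose_spec⟩⟩⟩

instance hasKernels_rightFreyd : HasKernels (RightFreyd T) where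
  has_limit f := by
    obtain ⟨f, rfl⟩ := (RightFreyd.quotient T).map_surjective f
    obtain ⟨_, _, _, _, _, ⟨h⟩⟩ := exists_kernel f
    exact ⟨_, h⟩

lemma exists_lift_of_mono (f : u ⟶ v) [hf : Mono ((RightFreyd.quotient T).map f)]
    (g : w ⟶ v) (hg : (RightFreyd.quotient T).map g ≫
      (RightFreyd.quotient T).map (RightFreyd.Candidate.π f) = 0) :
    ∃ l : w ⟶ u, (RightFreyd.quotient T).map l ≫ (RightFreyd.quotient T).map f =
      (RightFreyd.quotient T).map g := by
  rw [← Functor.map_comp, quotient_map_eq_zero_iff] at hg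
  obtain ⟨h, hh⟩ : ∃ h : w.right ⟶ v.left ⊞ u.right,
    g.right ≫ 𝟙 v.right = h ≫ biprod.desc v.hom f.right := hg
  have hh' : g.right = h ≫ biprod.fst ≫ v.hom + h ≫ biprod.snd ≫ f.right := by
    simpa [biprod.desc_eq] using hh
  let p : Arrow.mk (0 : w.left ⟶ w.left) ⟶ u := Arrow.homMk 0 (w.hom ≫ h ≫ biprod.snd) (by simp)
  have hz : (RightFreyd.quotient T).map p = 0 := by
    refine (Preadditive.mono_iff_cancel_zero _).1 hf _ _ ?_
    rw [← Functor.map_comp, quotient_map_eq_zero_iff]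
    refine ⟨g.left - w.hom ≫ h ≫ biprod.fst, ?_⟩
    have hgw : g.left ≫ v.hom = w.hom ≫ g.right := g.w
    rw [sub_comp, hgw, hh']
    simp [p]
  obtain ⟨q, hq⟩ := (quotient_map_eq_zero_iff _).1 hz
  refine ⟨Arrow.homMk q (h ≫ biprod.snd) (by simpa [p] using hq.symm), ?_⟩
  rw [← Functor.map_comp, quotient_map_eq_iff]
  exact ⟨- h ≫ biprod.fst, by simp [hh']⟩

instance isNormalMonoCategory_rightFreyd : IsNormalMonoCategory (RightFreyd T) where
  normalMonoOfMono {a b} f hf := by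
    obtain ⟨u, rfl⟩ : ∃ u, (RightFreyd.quotient T).obj u = a := ⟨a.as, rfl⟩
    obtain ⟨v, rfl⟩ : ∃ v, (RightFreyd.quotient T).obj v = b := ⟨b.as, rfl⟩
    obtain ⟨f, rfl⟩ := (RightFreyd.quotient T).map_surjective f
    have w : (RightFreyd.quotient T).map f ≫
        (RightFreyd.quotient T).map (RightFreyd.Candidate.π f) = 0 :=
      RightFreyd.Candidate.cokernelCofork f |>.condition
    have H (c : RightFreyd T) (g : c ⟶ (RightFreyd.quotient T).obj v)
        (hg : g ≫ (RightFreyd.quotient T).map (RightFreyd.Candidate.π f) = 0) :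
        ∃ l : c ⟶ (RightFreyd.quotient T).obj u, l ≫ (RightFreyd.quotient T).map f = g := by
      obtain ⟨w, rfl⟩ : ∃ w, (RightFreyd.quotient T).obj w = c := ⟨c.as, rfl⟩
      obtain ⟨g, rfl⟩ := (RightFreyd.quotient T).map_surjective g
      obtain ⟨l, hl⟩ := exists_lift_of_mono f g hg
      exact ⟨_, hl⟩
    exact ⟨{
      Z := _
      g := (RightFreyd.quotient T).map (RightFreyd.Candidate.π f)
      w := w
      isLimit := KernelFork.IsLimit.ofι' _ _ fun {c} g hg ↦ ⟨_, (H c g hg).choose_spec⟩ }⟩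

lemma exists_of_epi (f : u ⟶ v) [hf : Epi ((RightFreyd.quotient T).map f)] :
    ∃ (a : v.right ⟶ v.left) (b : v.right ⟶ u.right), b ≫ f.right = 𝟙 _ - a ≫ v.hom := by
  have hπ : (RightFreyd.quotient T).map (RightFreyd.Candidate.π f) = 0 := by
    rw [← cancel_epi ((RightFreyd.quotient T).map f), Limits.comp_zero]
    exact RightFreyd.Candidate.cokernelCofork f |>.condition
  obtain ⟨s, hs⟩ : ∃ s : v.right ⟶ v.left ⊞ u.right,
    𝟙 v.right = s ≫ biprod.desc v.hom f.right := (quotient_map_eq_zero_iff _).1 hπ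
  refine ⟨s ≫ biprod.fst, s ≫ biprod.snd, ?_⟩
  rw [hs, biprod.desc_eq]; simp

instance isNormalEpiCategory_rightFreyd : IsNormalEpiCategory (RightFreyd T) where
  normalEpiOfEpi {a b} f hf := by
    obtain ⟨u, rfl⟩ : ∃ u, (RightFreyd.quotient T).obj u = a := ⟨a.as, rfl⟩
    obtain ⟨v, rfl⟩ : ∃ v, (RightFreyd.quotient T).obj v = b := ⟨b.as, rfl⟩
    obtain ⟨f, rfl⟩ := (RightFreyd.quotient T).map_surjective f
    obtain ⟨k, ι, q, hι, hk, ⟨-⟩⟩ := exists_kernel f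
    have w : (RightFreyd.quotient T).map ι ≫ (RightFreyd.quotient T).map f = 0 := by
      rw [← Functor.map_comp, quotient_map_eq_zero_iff]; exact ⟨q, by simpa using hι⟩
    obtain ⟨a, b, hs'⟩ := exists_of_epi f
    have H (c : RightFreyd T) (g : (RightFreyd.quotient T).obj u ⟶ c)
        (hg : (RightFreyd.quotient T).map ι ≫ g = 0) :
        ∃ l : (RightFreyd.quotient T).obj v ⟶ c, (RightFreyd.quotient T).map f ≫ l = g := by
      obtain ⟨w, rfl⟩ : ∃ w, (RightFreyd.quotient T).obj w = c := ⟨c.as, rfl⟩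
      obtain ⟨g, rfl⟩ := (RightFreyd.quotient T).map_surjective g
      rw [← Functor.map_comp, quotient_map_eq_zero_iff] at hg
      obtain ⟨h, hh⟩ := hg
      replace hh : ι.right ≫ g.right = h ≫ w.hom := hh
      obtain ⟨t, ht, -⟩ := hk (v.hom ≫ b) (𝟙 _ - v.hom ≫ a) (by
        simp [hs'])
      obtain ⟨r, hr, -⟩ := hk (f.right ≫ b - 𝟙 _) (-f.right ≫ a) (by
        simp [hs'])
      refine ⟨(RightFreyd.quotient T).map (Arrow.homMk (t ≫ h) (b ≫ g.right) (by
        rw [assoc, ← hh, reassoc_of% ht])), ?_⟩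
      rw [← Functor.map_comp, quotient_map_eq_iff]
      refine ⟨r ≫ h, ?_⟩
      have hr' : f.right ≫ b ≫ g.right - g.right = (r ≫ h) ≫ w.hom := by
        rw [assoc, ← hh, reassoc_of% hr]
        simp
      exact hr'
    exact ⟨{
      W := _
      g := (RightFreyd.quotient T).map ι
      w := w
      isColimit := CokernelCofork.IsColimit.ofπ' _ _ fun {c} g hg ↦ ⟨_, (H c g hg).choose_spec⟩ }⟩

noncomputable instance abelian_rightFreyd : Abelian (RightFreyd T) where

/-- The morphism in the arrow category inducing the canonical epimorphism `proj`. -/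
noncomputable def projHom (u : Arrow T) : (RightFreyd.rightFunctor T).obj u.right ⟶ u where
  left := 0
  right := 𝟙 _
  w := by
    change 0 ≫ u.hom = 0 ≫ 𝟙 _
    simp

/-- The canonical epimorphism from the image of `u.right`. -/
noncomputable def proj (u : Arrow T) :
    (RightFreyd.functor T).obj u.right ⟶ (RightFreyd.quotient T).obj u :=
  (RightFreyd.quotient T).map (projHom u)

instance epi_proj (u : Arrow T) : Epi (proj u) :=
  have : IsIso (projHom u).right := inferInstanceAs (IsIso (𝟙 u.right))
  RightFreyd.epi_of_isIso_right _

lemma exists_eq_comp_proj {X : T} {u : Arrow T}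
    (x : (RightFreyd.functor T).obj X ⟶ (RightFreyd.quotient T).obj u) :
    ∃ p : X ⟶ u.right, x = (RightFreyd.functor T).map p ≫ proj u := by
  obtain ⟨x, rfl⟩ := (RightFreyd.quotient T).map_surjective x
  refine ⟨x.right, ?_⟩
  dsimp only [Functor.comp_map, proj]
  rw [← Functor.map_comp, quotient_map_eq_iff]
  refine ⟨0, ?_⟩
  change x.right - x.right ≫ 𝟙 _ = _
  simp

lemma map_comp_proj_eq_zero_iff {X : T} {u : Arrow T} (p : X ⟶ u.right) :
    (RightFreyd.functor T).map p ≫ proj u = 0 ↔ ∃ h : X ⟶ u.left, p = h ≫ u.hom := by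
  dsimp only [Functor.comp_map, proj]
  rw [← Functor.map_comp, quotient_map_eq_zero_iff]
  change (∃ h : X ⟶ u.left, p ≫ 𝟙 _ = h ≫ u.hom) ↔ _
  simp

lemma proj_comp_map (f : u ⟶ v) :
    proj u ≫ (RightFreyd.quotient T).map f = (RightFreyd.functor T).map f.right ≫ proj v := by
  dsimp only [Functor.comp_map, proj]
  rw [← Functor.map_comp, ← Functor.map_comp, quotient_map_eq_iff]
  refine ⟨0, ?_⟩
  change 𝟙 _ ≫ f.right - f.right ≫ 𝟙 _ = _
  rw [id_comp, comp_id, sub_self]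
  exact Limits.zero_comp.symm

instance projective_functor_obj (X : T) : Projective ((RightFreyd.functor T).obj X) where
  factors {a b} x f hf := by
    obtain ⟨u, rfl⟩ : ∃ u, (RightFreyd.quotient T).obj u = a := ⟨a.as, rfl⟩
    obtain ⟨v, rfl⟩ : ∃ v, (RightFreyd.quotient T).obj v = b := ⟨b.as, rfl⟩
    obtain ⟨f, rfl⟩ := (RightFreyd.quotient T).map_surjective f
    obtain ⟨a, b, hb⟩ := exists_of_epi f
    obtain ⟨p, rfl⟩ := exists_eq_comp_proj x
    refine ⟨(RightFreyd.functor T).map (p ≫ b) ≫ proj u, ?_⟩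
    rw [assoc, proj_comp_map, ← sub_eq_zero, ← assoc, ← sub_comp, ← Functor.map_comp,
      ← Functor.map_sub, map_comp_proj_eq_zero_iff]
    exact ⟨-p ≫ a, by simp [hb]⟩

instance isHomological_functor : (RightFreyd.functor T).IsHomological where
  exact D hD := by
    rw [ShortComplex.exact_iff_exact_up_to_refinements]
    intro a x hx
    obtain ⟨u, rfl⟩ : ∃ u, (RightFreyd.quotient T).obj u = a := ⟨a.as, rfl⟩
    change (RightFreyd.quotient T).obj u ⟶ (RightFreyd.functor T).obj D.obj₂ at x
    replace hx : x ≫ (RightFreyd.functor T).map D.mor₂ = 0 := hx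
    obtain ⟨y, hy⟩ := (RightFreyd.functor T).map_surjective (proj u ≫ x)
    have hy' : y ≫ D.mor₂ = 0 := by
      apply (RightFreyd.functor T).map_injective
      rw [Functor.map_comp, hy, assoc, Functor.map_zero, hx, Limits.comp_zero]
    obtain ⟨z, hz⟩ := D.coyoneda_exact₂ hD y hy'
    refine ⟨_, proj u, inferInstance, (RightFreyd.functor T).map z, ?_⟩
    change proj u ≫ x = (RightFreyd.functor T).map z ≫ (RightFreyd.functor T).map D.mor₁
    rw [← hy, ← Functor.map_comp, hz]

lemma exact_proj (u : Arrow T) :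
    (ShortComplex.mk ((RightFreyd.functor T).map u.hom) (proj u)
      ((map_comp_proj_eq_zero_iff _).2 ⟨𝟙 _, by simp⟩)).Exact := by
  rw [ShortComplex.exact_iff_exact_up_to_refinements]
  intro a x hx
  obtain ⟨v, rfl⟩ : ∃ v, (RightFreyd.quotient T).obj v = a := ⟨a.as, rfl⟩
  change (RightFreyd.quotient T).obj v ⟶ (RightFreyd.functor T).obj u.right at x
  replace hx : x ≫ proj u = 0 := hx
  obtain ⟨y, hy⟩ := (RightFreyd.functor T).map_surjective (proj v ≫ x)
  obtain ⟨h, hh⟩ := (map_comp_proj_eq_zero_iff y).1 (by rw [hy, assoc, hx, Limits.comp_zero])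
  refine ⟨_, proj v, inferInstance, (RightFreyd.functor T).map h, ?_⟩
  change proj v ≫ x = (RightFreyd.functor T).map h ≫ (RightFreyd.functor T).map u.hom
  rw [← hy, ← Functor.map_comp, hh]

section Extension

variable {A : Type*} [Category* A] [Abelian A] (F : T ⥤ A)

/-- The extension of `F` to arrows: the arrow `u` is sent to the cokernel of `F.map u.hom`. -/
noncomputable def extArrow : Arrow T ⥤ A where
  obj u := cokernel (F.map u.hom)
  map {u v} f := cokernel.map _ _ (F.map f.left) (F.map f.right) (by
    rw [← F.map_comp, ← F.map_comp]; exact congr(F.map $(f.w)).symm)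

/-- The extension to the Freyd category of an additive functor `F` on `T`. It sends
(the class of) an arrow `u` to the cokernel of `F.map u.hom`. -/
noncomputable def extend [F.Additive] : RightFreyd T ⥤ A :=
  CategoryTheory.Quotient.lift _ (extArrow F) (by
    rintro u v f g ⟨h⟩
    apply coequalizer.hom_ext
    dsimp [extArrow]
    simp only [cokernel.π_desc]
    rw [← sub_eq_zero, ← sub_comp, ← F.map_sub, h.comm, F.map_comp, assoc, cokernel.condition,
      Limits.comp_zero])

variable [F.Additive]

/-- The canonical epimorphism onto a value of the extension. -/
noncomputable def extπ (u : Arrow T) :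
    F.obj u.right ⟶ (extend F).obj ((RightFreyd.quotient T).obj u) :=
  cokernel.π (F.map u.hom)

instance epi_extπ (u : Arrow T) : Epi (extπ F u) := inferInstanceAs (Epi (cokernel.π _))

lemma exact_extπ (u : Arrow T) : (ShortComplex.mk (F.map u.hom) (extπ F u)
    (cokernel.condition _)).Exact :=
  ShortComplex.exact_of_g_is_cokernel _ (cokernelIsCokernel _)

lemma extπ_map (f : u ⟶ v) :
    extπ F u ≫ (extend F).map ((RightFreyd.quotient T).map f) = F.map f.right ≫ extπ F v :=
  cokernel.π_desc _ _ _

instance additive_extend : (extend F).Additive where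
  map_add {a b f g} := by
    obtain ⟨u, rfl⟩ : ∃ u, (RightFreyd.quotient T).obj u = a := ⟨a.as, rfl⟩
    obtain ⟨v, rfl⟩ : ∃ v, (RightFreyd.quotient T).obj v = b := ⟨b.as, rfl⟩
    obtain ⟨f, rfl⟩ := (RightFreyd.quotient T).map_surjective f
    obtain ⟨g, rfl⟩ := (RightFreyd.quotient T).map_surjective g
    rw [← cancel_epi (extπ F u), ← Functor.map_add, comp_add, extπ_map, extπ_map, extπ_map,
      ← add_comp, ← F.map_add]
    rfl

instance isIso_extπ (X : T) : IsIso (extπ F ((RightFreyd.rightFunctor T).obj X)) :=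
  have h (X Y : A) (f : X ⟶ Y) (hf : f = 0) : IsIso (cokernel.π f) := by subst hf; infer_instance
  h _ _ _ (F.map_zero _ _)

/-- The extension of `F` restricts to `F`. -/
noncomputable def extIso : RightFreyd.functor T ⋙ extend F ≅ F :=
  Iso.symm <| NatIso.ofComponents
    (fun X ↦ (@asIso _ _ _ _ (extπ F ((RightFreyd.rightFunctor T).obj X)) (isIso_extπ F X) :
      F.obj X ≅ (RightFreyd.functor T ⋙ extend F).obj X))
    (fun f ↦ (extπ_map F ((RightFreyd.rightFunctor T).map f)).symm)

lemma exists_eq_comp_extπ_of_exact_aux [F.IsHomological] {u v w : Arrow T} (f : u ⟶ v) (g : v ⟶ w)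
    (hfg : ∀ (X : T) (p : X ⟶ v.right) (h : X ⟶ w.left), p ≫ g.right = h ≫ w.hom →
      ∃ (l : X ⟶ u.right) (r : X ⟶ v.left), p = l ≫ f.right + r ≫ v.hom) 
    {a : A} (x : a ⟶ (extend F).obj ((RightFreyd.quotient T).obj v))
    (hx : x ≫ (extend F).map ((RightFreyd.quotient T).map g) = 0) :
    ∃ (a' : A) (π : a' ⟶ a) (_ : Epi π) (y : a' ⟶ (extend F).obj ((RightFreyd.quotient T).obj u)),
      π ≫ x = y ≫ (extend F).map ((RightFreyd.quotient T).map f) := by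
  obtain ⟨a₁, π₁, _, x₁, h₁⟩ := surjective_up_to_refinements_of_epi (extπ F v) x
  obtain ⟨a₂, π₂, _, x₂, h₂⟩ : ∃ (a₂ : A) (π₂ : a₂ ⟶ a₁) (_ : Epi π₂) (x₂ : a₂ ⟶ F.obj w.left),
      π₂ ≫ x₁ ≫ F.map g.right = x₂ ≫ F.map w.hom :=
    (exact_extπ F w).exact_up_to_refinements (x₁ ≫ F.map g.right) (by
      dsimp
      rw [assoc, ← extπ_map, ← reassoc_of% h₁, hx, Limits.comp_zero])
  obtain ⟨K, k, δ, hT⟩ := distinguished_cocone_triangle₁ (biprod.desc g.right (-w.hom))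
  have h₀ : k ≫ biprod.desc g.right (-w.hom) = 0 := comp_distTriang_mor_zero₁₂ _ hT
  have h₆ : ((π₂ ≫ x₁) ≫ F.map biprod.inl + x₂ ≫ F.map biprod.inr) ≫
      F.map (biprod.desc g.right (-w.hom)) = 0 := by
    simp only [add_comp, assoc, ← F.map_comp, biprod.inl_desc, biprod.inr_desc, F.map_neg,
      comp_neg, h₂, add_neg_cancel]
  obtain ⟨a₃, π₃, _, x₃, h₃⟩ : ∃ (a₃ : A) (π₃ : a₃ ⟶ a₂) (_ : Epi π₃) (x₃ : a₃ ⟶ F.obj K),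
      π₃ ≫ ((π₂ ≫ x₁) ≫ F.map biprod.inl + x₂ ≫ F.map biprod.inr) = x₃ ≫ F.map k :=
    (F.map_distinguished_exact _ hT).exact_up_to_refinements _ h₆
  rw [biprod.desc_eq, comp_add, comp_neg, comp_neg, add_neg_eq_zero] at h₀
  obtain ⟨l, r, hlr⟩ := hfg K (k ≫ biprod.fst) (k ≫ biprod.snd) (by simpa using h₀)
  have h₄ : π₃ ≫ π₂ ≫ x₁ = x₃ ≫ F.map (k ≫ biprod.fst) := by
    have := congr($h₃ ≫ F.map biprod.fst)
    simpa only [assoc, add_comp, ← F.map_comp, biprod.inl_fst, biprod.inr_fst, F.map_zero,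
      Limits.comp_zero, add_zero, F.map_id, comp_id, comp_add] using this
  refine ⟨a₃, π₃ ≫ π₂ ≫ π₁, inferInstance, x₃ ≫ F.map l ≫ extπ F u, ?_⟩
  have h₅ : F.map v.hom ≫ extπ F v = 0 := cokernel.condition _
  rw [assoc, assoc, assoc, assoc, extπ_map, h₁, reassoc_of% h₄, hlr, F.map_add, F.map_comp, F.map_comp]
  simp [h₅]

lemma exactFunctor_ext [F.IsHomological] : exactFunctor _ _ (extend F) := by
  refine ((extend F).exact_tfae.out 1 3).1 fun S hS ↦ ?_
  suffices ∀ {a b c : RightFreyd T} (f : a ⟶ b) (g : b ⟶ c) (w : f ≫ g = 0)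
      (_ : (ShortComplex.mk f g w).Exact), ((ShortComplex.mk f g w).map (extend F)).Exact from
    this S.f S.g S.zero hS
  intro a b c f g w hS
  obtain ⟨u, rfl⟩ : ∃ u, (RightFreyd.quotient T).obj u = a := ⟨a.as, rfl⟩
  obtain ⟨v, rfl⟩ : ∃ v, (RightFreyd.quotient T).obj v = b := ⟨b.as, rfl⟩
  obtain ⟨z, rfl⟩ : ∃ z, (RightFreyd.quotient T).obj z = c := ⟨c.as, rfl⟩
  obtain ⟨f, rfl⟩ := (RightFreyd.quotient T).map_surjective f
  obtain ⟨g, rfl⟩ := (RightFreyd.quotient T).map_surjective g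
  rw [ShortComplex.exact_iff_exact_up_to_refinements]
  intro a x hx
  refine exists_eq_comp_extπ_of_exact_aux F f g (fun X p h hp ↦ ?_) x hx
  let y : (RightFreyd.functor T).obj X ⟶ (RightFreyd.quotient T).obj v :=
    (RightFreyd.functor T).map p ≫ proj v
  have hy : y ≫ (RightFreyd.quotient T).map g = 0 := by
    dsimp only [y]
    rw [assoc, proj_comp_map, ← assoc, ← Functor.map_comp, map_comp_proj_eq_zero_iff]
    exact ⟨h, hp⟩
  obtain ⟨t, ht⟩ : ∃ t, t ≫ (RightFreyd.quotient T).map f = y :=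
    ⟨hS.liftFromProjective y hy, hS.liftFromProjective_comp y hy⟩
  obtain ⟨l, rfl⟩ := exists_eq_comp_proj t
  rw [assoc, proj_comp_map, ← assoc, ← Functor.map_comp, ← sub_eq_zero] at ht
  dsimp only [y] at ht
  rw [← sub_comp, ← Functor.map_sub, map_comp_proj_eq_zero_iff] at ht
  obtain ⟨r, hr⟩ := ht
  exact ⟨l, -r, by rw [neg_comp, ← hr]; abel⟩

end Extension

section Restriction

variable (T) (A : Type*) [Category* A] [Abelian A]

/-- The property of being a (covariant) cohomological functor `T ⥤ A`: exact triangles are sent to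
exact sequences. -/
def homologicalFunctor : ObjectProperty (T ⥤ A) := fun F ↦ F.IsHomological

variable {T A}

lemma additive_of_exact (G : RightFreyd T ⥤ A) (hG : exactFunctor _ _ G) : G.Additive := by
  have : PreservesFiniteLimits G := hG.1
  exact G.additive_of_preserves_binary_products

lemma map_exact (G : RightFreyd T ⥤ A) [G.Additive] (hG : exactFunctor _ _ G)
    (S : ShortComplex (RightFreyd T)) (hS : S.Exact) : (S.map G).Exact :=
  ((G.exact_tfae.out 3 1).1 hG :) S hS

lemma isHomological_functor_comp (G : RightFreyd T ⥤ A) (hG : exactFunctor _ _ G) :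
    (RightFreyd.functor T ⋙ G).IsHomological :=
  have := additive_of_exact G hG
  { exact D hD := map_exact G hG _ ((RightFreyd.functor T).map_distinguished_exact D hD) }

variable (T A)

/-- Restriction along `T ⥤ RightFreyd T`, from the category of exact functors on the Freyd category
to the category of cohomological functors on `T`. -/
noncomputable def restriction : (RightFreyd T ⥤ₑ A) ⥤ (homologicalFunctor T A).FullSubcategory :=
  ObjectProperty.lift _ (ExactFunctor.forget _ _ ⋙
    (Functor.whiskeringLeft _ _ A).obj (RightFreyd.functor T))
    fun G ↦ isHomological_functor_comp G.obj G.property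

variable {T A}

lemma epi_map_proj (G : RightFreyd T ⥤ A) (hG : exactFunctor _ _ G) (u : Arrow T) :
    Epi (G.map (proj u)) :=
  have : PreservesFiniteColimits G := hG.2
  inferInstance

lemma exists_natTrans (G G' : RightFreyd T ⥤ A) (hG : exactFunctor _ _ G)
    (hG' : exactFunctor _ _ G') (η : RightFreyd.functor T ⋙ G ⟶ RightFreyd.functor T ⋙ G') :
    ∃ τ : G ⟶ G', Functor.whiskerLeft (RightFreyd.functor T) τ = η := by
  have := additive_of_exact G hG
  have := additive_of_exact G' hG'
  have := epi_map_proj G hG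
  have H (u : Arrow T) : ∃ t : G.obj ((RightFreyd.quotient T).obj u) ⟶
      G'.obj ((RightFreyd.quotient T).obj u),
      G.map (proj u) ≫ t = η.app u.right ≫ G'.map (proj u) := by
    have hS := map_exact G hG _ (exact_proj u)
    have hw : (RightFreyd.functor T).map u.hom ≫ proj u = 0 :=
      (map_comp_proj_eq_zero_iff _).2 ⟨𝟙 _, by simp⟩
    have : Epi ((ShortComplex.mk _ _ hw).map G).g := epi_map_proj G hG u
    refine ⟨hS.desc (η.app u.right ≫ G'.map (proj u)) ?_, hS.g_desc _ _⟩
    have h := η.naturality u.hom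
    change G.map ((RightFreyd.functor T).map u.hom) ≫ η.app u.right ≫ G'.map (proj u) = 0
    have h' : G.map ((RightFreyd.functor T).map u.hom) ≫ η.app u.right =
      η.app u.left ≫ G'.map ((RightFreyd.functor T).map u.hom) := h
    rw [← assoc, h', assoc, ← G'.map_comp, hw, G'.map_zero, Limits.comp_zero]
  choose t ht using H
  have hnat (u v : Arrow T) (f : u ⟶ v) : G.map ((RightFreyd.quotient T).map f) ≫ t v =
      t u ≫ G'.map ((RightFreyd.quotient T).map f) := by
    have h' : G.map ((RightFreyd.functor T).map f.right) ≫ η.app v.right =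
      η.app u.right ≫ G'.map ((RightFreyd.functor T).map f.right) := η.naturality f.right
    rw [← cancel_epi (G.map (proj u)), reassoc_of% ht u, ← G'.map_comp, ← G.map_comp_assoc,
      proj_comp_map, G.map_comp, G'.map_comp, assoc, ht, ← assoc, h', assoc]
  refine ⟨CategoryTheory.Quotient.natTransLift _ { app := t, naturality := hnat }, ?_⟩
  ext X
  have hp : projHom ((RightFreyd.rightFunctor T).obj X) = 𝟙 _ := by
    apply Arrow.hom_ext
    · exact (isZero_zero T).eq_of_src _ _
    · rfl
  have h : G.map ((RightFreyd.quotient T).map (projHom ((RightFreyd.rightFunctor T).obj X))) ≫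
      t ((RightFreyd.rightFunctor T).obj X) = η.app X ≫
    G'.map ((RightFreyd.quotient T).map (projHom ((RightFreyd.rightFunctor T).obj X))) := ht _
  have hp' (G : RightFreyd T ⥤ A) :
      G.map ((RightFreyd.quotient T).map (projHom ((RightFreyd.rightFunctor T).obj X))) =
        𝟙 (G.obj ((RightFreyd.functor T).obj X)) :=
    (congrArg (fun f : (RightFreyd.rightFunctor T).obj X ⟶ (RightFreyd.rightFunctor T).obj X ↦
      G.map ((RightFreyd.quotient T).map f)) hp).trans
      ((congrArg G.map ((RightFreyd.quotient T).map_id _)).trans (G.map_id _))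
  have h₁ := (congrArg (fun f ↦ f ≫ t ((RightFreyd.rightFunctor T).obj X)) (hp' G)).trans
    (id_comp _)
  have h₂ := (congrArg (fun f ↦ η.app X ≫ f) (hp' G')).trans (comp_id _)
  exact h₁.symm.trans (h.trans h₂)

lemma natTrans_ext' (G G' : RightFreyd T ⥤ A) (hG : exactFunctor _ _ G)
    (τ τ' : G ⟶ G')
    (h : Functor.whiskerLeft (RightFreyd.functor T) τ =
      Functor.whiskerLeft (RightFreyd.functor T) τ') : τ = τ' := by
  ext a
  obtain ⟨u, rfl⟩ : ∃ u, (RightFreyd.quotient T).obj u = a := ⟨a.as, rfl⟩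
  have := epi_map_proj G hG u
  have h' : τ.app ((RightFreyd.functor T).obj u.right) =
    τ'.app ((RightFreyd.functor T).obj u.right) := congr(($h).app u.right)
  rw [← cancel_epi (G.map (proj u)), τ.naturality, τ'.naturality, h']

variable (T A)

instance faithful_restriction : (restriction T A).Faithful where
  map_injective {G G'} τ τ' h := by
    apply ObjectProperty.hom_ext
    exact natTrans_ext' _ _ G.property _ _ congr(($h).hom)

instance full_restriction : (restriction T A).Full where
  map_surjective {G G'} η := by
    obtain ⟨τ, hτ⟩ := exists_natTrans _ _ G.property G'.property η.hom
    exact ⟨ObjectProperty.homMk τ, ObjectProperty.hom_ext _ hτ⟩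

instance essSurj_restriction : (restriction T A).EssSurj where
  mem_essImage F :=
    have : F.obj.IsHomological := F.property
    ⟨⟨extend F.obj, exactFunctor_ext F.obj⟩, ⟨ObjectProperty.isoMk _ (extIso F.obj)⟩⟩

/-- The universal property of the abelianisation. -/
instance isEquivalence_restriction : (restriction T A).IsEquivalence where

end Restriction

end Freyd

section Statement

/-- The abelianisation `Ab T` of a triangulated category `T`, realised as the Freyd category of
`T`: an object is an arrow `u` of `T` (standing for the cokernel of
`Hom(-, u.left) ⟶ Hom(-, u.right)`), and a morphism is a commutative square up to those whose
right component `u.right ⟶ v.right` factors through `v`. It is an abelian category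
(`abelian_rightFreyd`) and the functor `ι` below has the universal property of the abelianisation:
`ι` is fully faithful and cohomological, and restriction along `ι` is an equivalence from exact
functors on `Ab T` to cohomological functors on `T` (`isEquivalence_restriction`). -/
abbrev Ab (T : Type*) [Category* T] [Preadditive T] := RightFreyd T

variable {T : Type*} [Category* T] [Preadditive T] [HasZeroObject T] [HasShift T ℤ]
  [∀ n : ℤ, (shiftFunctor T n).Additive] [Pretriangulated T]
  {D : Type*} [Category* D] [Preadditive D] [HasZeroObject D] [HasShift D ℤ]
  [∀ n : ℤ, (shiftFunctor D n).Additive] [Pretriangulated D]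

variable (T) in
/-- The canonical functor `T ⥤ Ab T`, sending `X` to the class of `0 ⟶ X`. -/
noncomputable abbrev ι : T ⥤ Ab T := RightFreyd.functor T

/-- The canonical functor `Ab T ⥤ Ab D` induced by a triangulated functor `L : T ⥤ D`: the exact
functor on `Ab T` which extends the cohomological functor `L ⋙ ι D`. -/
noncomputable def mapAb (L : T ⥤ D) [L.CommShift ℤ] [L.IsTriangulated] : Ab T ⥤ Ab D :=
  extend (L ⋙ ι D)

/-- The Serre subcategory generated by a class of objects in an abelian category, i.e. the
intersection of all the Serre subcategories containing it. -/
def serreClosure {A : Type*} [Category* A] [Abelian A] (P : ObjectProperty A) :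
    ObjectProperty A :=
  fun X ↦ ∀ Q : ObjectProperty A, Q.IsSerreClass → P ≤ Q → Q X

instance isSerreClass_serreClosure {A : Type*} [Category* A] [Abelian A] (P : ObjectProperty A) :
    (serreClosure P).IsSerreClass where
  exists_zero := ⟨_, isZero_zero A, fun Q _ _ ↦ Q.prop_zero⟩
  prop_of_mono f _ hY := fun Q hQ h ↦ Q.prop_of_mono f (hY Q hQ h)
  prop_of_epi f _ hX := fun Q hQ h ↦ Q.prop_of_epi f (hX Q hQ h)
  prop_X₂_of_shortExact hS h₁ h₃ := fun Q hQ h ↦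
    Q.prop_X₂_of_shortExact hS (h₁ Q hQ h) (h₃ Q hQ h)

/-- The Serre subcategory `Ab_S(T)` of `Ab T` generated by the image of `S` under `ι T`. -/
noncomputable def serreSub (S : ObjectProperty T) : ObjectProperty (Ab T) :=
  serreClosure (S.map (ι T))

noncomputable instance isSerreClass_serreSub (S : ObjectProperty T) : (serreSub S).IsSerreClass :=
  isSerreClass_serreClosure _

end Statement

end Abelianisation

namespace Abelianisation

section VerdierQuotient

variable {T : Type*} [Category* T] [Preadditive T] [HasZeroObject T] [HasShift T ℤ]
  [∀ n : ℤ, (shiftFunctor T n).Additive] [Pretriangulated T]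
  {D : Type*} [Category* D] [Preadditive D] [HasZeroObject D] [HasShift D ℤ]
  [∀ n : ℤ, (shiftFunctor D n).Additive] [Pretriangulated D]
  {A : Type*} [Category* A] [Abelian A]

/-! Both sides solve the same universal problem. Exact functors out of `Ab D` are cohomological
functors on `D`, hence cohomological functors on `T` that vanish on `S`; exact functors out of the
Serre quotient are exact functors on `Ab T` killing the generators `ι T X` with `X` in `S`, hence
again cohomological functors on `T` that vanish on `S`.

The proof turns this into an explicit inverse. Write `q` for the Serre quotient functor and `Φ` for
the induced functor, so that `q ⋙ Φ = mapAb L`. The cohomological functor `ι T ⋙ q` vanishes on `S`,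
so it inverts the morphisms with cone in `S` (`trW_isInvertedBy_of_isHomological`) and factors
through `L` as some `H`. This `H` is again cohomological, and its exact extension `E` to `Ab D` is
the candidate inverse.

Both composites are identified with identities by uniqueness: exact functors on an abelianisation
are determined by their restriction (`nonempty_iso_of_exact`), and functors out of a localisation by
their precomposition with it. -/

/-! ### Exact functors on the abelianisation -/

lemma exactFunctor_comp {B₁ B₂ B₃ : Type*} [Category* B₁] [Category* B₂] [Category* B₃]
    (F : B₁ ⥤ B₂) (G : B₂ ⥤ B₃) (hF : exactFunctor _ _ F) (hG : exactFunctor _ _ G) :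
    exactFunctor _ _ (F ⋙ G) :=
  have : PreservesFiniteLimits F := hF.1
  have : PreservesFiniteColimits F := hF.2
  have : PreservesFiniteLimits G := hG.1
  have : PreservesFiniteColimits G := hG.2
  ⟨comp_preservesFiniteLimits F G, comp_preservesFiniteColimits F G⟩

/-- Exact functors on the abelianisation which agree on `T` are isomorphic. -/
lemma nonempty_iso_of_exact (G G' : Ab T ⥤ A) (hG : exactFunctor _ _ G)
    (hG' : exactFunctor _ _ G') (e : ι T ⋙ G ≅ ι T ⋙ G') : Nonempty (G ≅ G') := by
  -- Restriction along `ι T` is fully faithful on exact functors, so it reflects this isomorphism.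
  let e' : (restriction T A).obj ⟨G, hG⟩ ≅ (restriction T A).obj ⟨G', hG'⟩ :=
    ObjectProperty.isoMk _ e
  exact ⟨(exactFunctor _ _).ι.mapIso ((restriction T A).preimageIso e')⟩

/-! ### Vanishing on `S` versus inverting morphisms with cone in `S` -/

/-- A homological functor vanishing on `S` inverts the morphisms with cone in `S`. -/
lemma trW_isInvertedBy_of_isHomological (S : ObjectProperty T) [S.IsStableUnderShift ℤ]
    (F : T ⥤ A) [F.IsHomological] (hF : ∀ X, S X → IsZero (F.obj X)) :
    S.trW.IsInvertedBy F := by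
  intro X Y f hf
  let := Functor.ShiftSequence.tautological F ℤ
  -- The homological kernel asks that `F` vanish on all shifts of an object; stability of `S` under
  -- shifts provides this. Membership of `f` in the class attached to this kernel means that `F`
  -- inverts every shift of `f`, and degree `0` is the case needed.
  have hS : S ≤ F.homologicalKernel := fun X hX n ↦ hF _ (S.le_shift n _ hX)
  have hiso := (F.mem_homologicalKernel_trW_iff f).1 (ObjectProperty.trW_monotone hS _ hf) 0
  exact (NatIso.isIso_map_iff (F.isoShiftZero ℤ) f).1 hiso

/-- A triangulated functor inverting the morphisms with cone in `S` vanishes on `S`. -/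
lemma isZero_obj_of_trW_isInvertedBy (S : ObjectProperty T) [S.IsStableUnderShift ℤ]
    (L : T ⥤ D) [L.CommShift ℤ] [L.IsTriangulated] (hL : S.trW.IsInvertedBy L)
    {X : T} (hX : S X) : IsZero (L.obj X) := by
  -- The rotated contractible triangle `X ⟶ 0 ⟶ X⟦1⟧` exhibits `X ⟶ 0` as a morphism with cone in
  -- `S`, so `L` makes it an isomorphism.
  have hT := rot_of_distTriang _ (contractible_distinguished X)
  have := hL _ (ObjectProperty.trW.mk S hT (S.le_shift (1 : ℤ) _ hX))
  exact (asIso (L.map (contractibleTriangle X).rotate.mor₁)).isZero_iff.2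
    (L.map_isZero (isZero_zero T))

/-! ### The induced functor on the Serre quotient -/

lemma serreClosure_le {B : Type*} [Category* B] [Abelian B] (P Q : ObjectProperty B)
    [Q.IsSerreClass] (h : P ≤ Q) : serreClosure P ≤ Q :=
  fun _ hX ↦ hX Q inferInstance h

lemma exactFunctor_mapAb (L : T ⥤ D) [L.CommShift ℤ] [L.IsTriangulated] :
    exactFunctor _ _ (mapAb L) :=
  exactFunctor_ext (L ⋙ ι D)

/-- The extension of `L ⋙ ι D` restricts to `L ⋙ ι D`. -/
noncomputable def mapAbIso (L : T ⥤ D) [L.CommShift ℤ] [L.IsTriangulated] :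
    ι T ⋙ mapAb L ≅ L ⋙ ι D :=
  extIso (L ⋙ ι D)

/-- An exact functor inverts the isomorphisms modulo a Serre class as soon as it kills that class.
Its kernel is itself a Serre class, so only the generators `ι T X` need checking; they go to `ι D (L
X)`, which is zero because `L X` is. -/
lemma isoModSerre_isInvertedBy_mapAb (S : ObjectProperty T) [S.IsStableUnderShift ℤ]
    (L : T ⥤ D) [L.CommShift ℤ] [L.IsTriangulated] (hL : S.trW.IsInvertedBy L) :
    (serreSub S).isoModSerre.IsInvertedBy (mapAb L) := by
  have : PreservesFiniteLimits (mapAb L) := (exactFunctor_mapAb L).1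
  have : PreservesFiniteColimits (mapAb L) := (exactFunctor_mapAb L).2
  rw [ObjectProperty.isoModSerre_isInvertedBy_iff]
  refine serreClosure_le _ _ ?_
  rintro Y ⟨X, hX, ⟨e⟩⟩
  have hZ : IsZero ((ι D).obj (L.obj X)) :=
    (ι D).map_isZero (isZero_obj_of_trW_isInvertedBy S L hL hX)
  exact hZ.of_iso ((mapAb L).mapIso e.symm ≪≫ (mapAbIso L).app X)

/-- The induced functor from the Serre quotient is an equivalence. -/
lemma isEquivalence_lift_mapAb [IsTriangulated T] (S : ObjectProperty T) [S.IsTriangulated]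
    (L : T ⥤ D) [L.CommShift ℤ] [L.IsTriangulated] [L.IsLocalization S.trW]
    (h : (serreSub S).isoModSerre.IsInvertedBy (mapAb L)) :
    (Localization.Construction.lift (mapAb L) h :
      (serreSub S).isoModSerre.Localization ⥤ Ab D).IsEquivalence := by
  let q := (serreSub S).isoModSerre.Q
  let Φ : (serreSub S).isoModSerre.Localization ⥤ Ab D := Localization.Construction.lift _ h
  have hΦ : q ⋙ Φ = mapAb L := Localization.Construction.fac _ _
  let : Abelian (serreSub S).isoModSerre.Localization :=
    ObjectProperty.SerreClassLocalization.abelian q (serreSub S)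
  have hq : exactFunctor _ _ q :=
    ⟨ObjectProperty.SerreClassLocalization.preservesFiniteLimits q (serreSub S),
      ObjectProperty.SerreClassLocalization.preservesFiniteColimits q (serreSub S)⟩
  have hΦ' : exactFunctor _ _ Φ := by
    -- Exactness of a functor on the Serre quotient can be tested after precomposition with `q`.
    rw [← ObjectProperty.SerreClassLocalization.exactFunctor_comp_iff q (serreSub S), hΦ]
    exact exactFunctor_mapAb L
  have := isHomological_functor_comp q hq
  have hinv : S.trW.IsInvertedBy (ι T ⋙ q) :=
    trW_isInvertedBy_of_isHomological S _ fun X hX ↦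
      (ObjectProperty.SerreClassLocalization.isZero_obj_iff q (serreSub S) _).2
        fun Q _ hQ ↦ hQ _ (S.prop_map_obj _ hX)
  let H : D ⥤ (serreSub S).isoModSerre.Localization := Localization.lift (ι T ⋙ q) hinv L
  let eH : L ⋙ H ≅ ι T ⋙ q := Localization.fac _ hinv L
  -- By calculus of fractions every arrow of `D` is, up to isomorphism, the image of an arrow of
  -- `T`. Distinguished triangles of `D` therefore lift to `T` up to isomorphism, and `H` inherits
  -- exactness from `ι T ⋙ q`.
  have := Localization.essSurj_mapArrow L S.trW
  have : H.IsHomological := Functor.isHomological_of_localization L H _ eH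
  let E : Ab D ⥤ (serreSub S).isoModSerre.Localization := extend H
  have hE : exactFunctor _ _ E := exactFunctor_ext H
  obtain ⟨e₁⟩ : Nonempty (mapAb L ⋙ E ≅ q) := by
    -- On `T` both functors restrict to `L ⋙ H`, up to isomorphism.
    refine nonempty_iso_of_exact _ _ (exactFunctor_comp _ _ (exactFunctor_mapAb L) hE) hq ?_
    exact Functor.isoWhiskerRight (mapAbIso L) E ≪≫ Functor.isoWhiskerLeft L (extIso H) ≪≫ eH
  have e₂ : q ⋙ Φ ⋙ E ≅ q ⋙ 𝟭 _ := Functor.isoWhiskerRight (eqToIso hΦ) E ≪≫ e₁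
  have unit : Φ ⋙ E ≅ 𝟭 _ :=
    Localization.liftNatIso q (serreSub S).isoModSerre _ _ _ _ e₂
  have e₃ : L ⋙ H ⋙ Φ ≅ L ⋙ ι D :=
    Functor.isoWhiskerRight eH Φ ≪≫ Functor.isoWhiskerLeft (ι T) (eqToIso hΦ) ≪≫ mapAbIso L
  -- The universal property of `L` cancels it from `e₃`; this is the agreement on `D` from which the
  -- counit is obtained.
  have e₄ : H ⋙ Φ ≅ ι D := Localization.liftNatIso L S.trW _ _ _ _ e₃
  obtain ⟨counit⟩ : Nonempty (E ⋙ Φ ≅ 𝟭 _) := by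
    refine nonempty_iso_of_exact _ _ (exactFunctor_comp _ _ hE hΦ')
      ⟨inferInstanceAs (PreservesFiniteLimits (𝟭 (Ab D))),
        inferInstanceAs (PreservesFiniteColimits (𝟭 (Ab D)))⟩ ?_
    exact Functor.isoWhiskerRight (extIso H) Φ ≪≫ e₄
  exact (CategoryTheory.Equivalence.mk Φ E unit.symm counit).isEquivalence_functor

end VerdierQuotient

end Abelianisation

theorem mainTheorem1 {T : Type*} [Category* T] [Preadditive T] [HasZeroObject T] [HasShift T ℤ]
    [∀ n : ℤ, (shiftFunctor T n).Additive] [Pretriangulated T] [IsTriangulated T]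
    (S : ObjectProperty T) [S.IsTriangulated]
    {D : Type*} [Category* D] [Preadditive D] [HasZeroObject D] [HasShift D ℤ]
    [∀ n : ℤ, (shiftFunctor D n).Additive] [Pretriangulated D]
    (L : T ⥤ D) [L.CommShift ℤ] [L.IsTriangulated] [L.IsLocalization S.trW] :
    exactFunctor (Abelianisation.Ab T) (Abelianisation.Ab D) (Abelianisation.mapAb L) ∧
    Nonempty (Abelianisation.ι T ⋙ Abelianisation.mapAb L ≅ L ⋙ Abelianisation.ι D) ∧
    ∃ h : (Abelianisation.serreSub S).isoModSerre.IsInvertedBy (Abelianisation.mapAb L),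
      (Localization.Construction.lift (Abelianisation.mapAb L) h :
        (Abelianisation.serreSub S).isoModSerre.Localization ⥤ Abelianisation.Ab D).IsEquivalence := by
  have h := Abelianisation.isoModSerre_isInvertedBy_mapAb S L (Localization.inverts L S.trW)
  exact ⟨Abelianisation.exactFunctor_mapAb L, ⟨Abelianisation.mapAbIso L⟩, h,
    Abelianisation.isEquivalence_lift_mapAb S L h⟩
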